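/- All rings are commutative with unit. Let $R\subseteq S$ be a ring extension and let $[R,S]$ be the set of all $R$-subalgebras of $S$, ordered by inclusion; for a subring $A$ of $S$, write $[A,S]$ similarly. The extension $R\subseteq S$ is called FMC if $[R,S]$ contains a finite maximal chain (that is, a finite chain $R=R_0\subset R_1\subset\cdots\subset R_n=S$ such that no ring lies strictly between $R_i$ and $R_{i+1}$, for $0\le i<n$). An extension $A\subseteq S$ is called Prüfer if for every $T\in[A,S]$ the inclusion $A\to T$ is a flat epimorphism of commutative rings. The extension $R\subseteq S$ is called quasi-Prüfer if $\overline R\subseteq S$ is Prüfer, where $\overline R$ is the integral closure of $R$ in $S$. Then every FMC extension $R\subseteq S$ is quasi-Prüfer. -/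

import Mathlib

/-- A ring extension `R ⊆ S` is given by an injective algebra map (`FaithfulSMul R S`), and the
intermediate rings `[R, S]` are the elements of `Subalgebra R S`.
The extension is FMC if some maximal chain of intermediate rings is finite. -/
def IsFMCExtension (R S : Type*) [CommRing R] [CommRing S] [Algebra R S] [FaithfulSMul R S] :
    Prop :=
  ∃ C : Set (Subalgebra R S), IsMaxChain (· ≤ ·) C ∧ C.Finite

/-- A ring extension `R ⊆ S` is Prüfer if `R ⊆ T` is a flat epimorphism of commutative rings
for every intermediate ring `T`. -/
def IsPruferExtension (R S : Type*) [CommRing R] [CommRing S] [Algebra R S] [FaithfulSMul R S] :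
    Prop :=
  ∀ T : Subalgebra R S, Module.Flat R T ∧ Algebra.IsEpi R T

/-- A ring extension `R ⊆ S` is quasi-Prüfer if `R' ⊆ S` is Prüfer, where `R'` is the integral
closure of `R` in `S`. -/
def IsQuasiPruferExtension (R S : Type*) [CommRing R] [CommRing S] [Algebra R S]
    [FaithfulSMul R S] : Prop :=
  IsPruferExtension (integralClosure R S) S

open Polynomial TensorProduct

/-! Primitivity is the bridge from chains to flatness. Let `A` be integrally closed in `T` and f(t)
= 0. If a is the leading coefficient, at is integral, hence in `A`; trading the top term for one of
lower degree shows inductively that the coefficients of f lie in every ideal containing all pairs m,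
mt from `A` (`coeff_mem_of_aeval_eq_zero`). So if t is primitive, no prime of `T` contains all its
denominators: they generate the unit ideal of `T`. If this holds for all t, A → T is a flat
epimorphism.

It remains to get primitivity from a finite maximal chain. In a minimal extension of U, the ring
U[s²] is U or contains s, so s is a root of X² - s² or of some X - g(X²). These relations compose
(`IsPrimitiveOver.trans`): over the integral closure, denominators can be cleared without all
coefficients falling into a given prime, and primitivity descends from there by going-up and
incomparability for polynomial rings. -/

/-- `s` is *primitive* over `R` if for every prime `p` of `R` it is a root of a polynomial over `R`
that is nonzero modulo `p`. -/
def IsPrimitiveOver (R : Type*) {S : Type*} [CommRing R] [CommRing S] [Algebra R S] (s : S) :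
    Prop :=
  ∀ p : Ideal R, p.IsPrime → ∃ f : R[X], aeval s f = 0 ∧ ∃ i, f.coeff i ∉ p

/-! ### Denominators over an integrally closed subring -/

/-- If `A` is integrally closed in `B` and `f(b) = 0` with `f` over `A`, then the coefficients of
`f` lie in every ideal containing all `m` and `m * b` with `m` and `m * b` in `A`. -/
theorem coeff_mem_of_aeval_eq_zero {A B : Type*} [CommRing A] [CommRing B] [Algebra A B]
    (hAB : ∀ x : B, IsIntegral A x → x ∈ (algebraMap A B).range) {b : B} {I : Ideal A}
    (hI : ∀ m a : A, algebraMap A B a = m • b → m ∈ I ∧ a ∈ I)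
    {f : A[X]} (hf : aeval b f = 0) (i : ℕ) : f.coeff i ∈ I := by
  obtain ⟨n, hn⟩ : ∃ n, f.natDegree ≤ n := ⟨_, le_rfl⟩
  induction n generalizing f i with
  | zero =>
    rw [natDegree_le_iff_coeff_eq_zero] at hn
    obtain rfl | hi := Nat.eq_zero_or_pos i
    · have hC : f = C (f.coeff 0) := by
        ext j
        obtain rfl | hj := Nat.eq_zero_or_pos j
        · simp
        · rw [hn j hj, coeff_C_of_ne_zero hj.ne']
      rw [hC, aeval_C] at hf
      exact (hI 0 _ (by rw [hf, zero_smul])).2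
    · rw [hn i hi]
      exact I.zero_mem
  | succ n ih =>
    obtain hlt | heq := hn.lt_or_eq
    · exact ih hf i (Nat.lt_succ_iff.mp hlt)
    have hint := isIntegral_leadingCoeff_smul f b hf
    obtain ⟨c, hc⟩ := hAB _ hint
    obtain ⟨haI, hcI⟩ := hI _ _ hc
    set a := f.leadingCoeff with ha
    have hac : f.coeff (n + 1) = a := by rw [ha, leadingCoeff, heq]
    -- As ab = c, replacing aX^(n+1) by cX^n keeps the root b and lowers the degree; coefficients
    -- change only by a and c, both in `I`.
    have key := @ih (f - C a * X ^ (n + 1) + C c * X ^ n) (by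
      simp only [map_add, map_sub, map_mul, aeval_C, map_pow, aeval_X, hf, hc, Algebra.smul_def]
      ring) i (by
      rw [natDegree_le_iff_coeff_eq_zero]
      intro N hN
      simp only [coeff_add, coeff_sub, coeff_C_mul, coeff_X_pow, if_neg hN.ne']
      obtain rfl | hN' := eq_or_ne N (n + 1)
      · simp [hac]
      · rw [if_neg hN', coeff_eq_zero_of_natDegree_lt (by omega)]
        simp)
    have hrw : f.coeff i = (f - C a * X ^ (n + 1) + C c * X ^ n).coeff i
        + (a * (X ^ (n + 1) : A[X]).coeff i - c * (X ^ n : A[X]).coeff i) := by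
      simp only [coeff_add, coeff_sub, coeff_C_mul]
      ring
    rw [hrw]
    exact I.add_mem key (I.sub_mem (I.mul_mem_right _ haI) (I.mul_mem_right _ hcI))

/-- Simultaneous denominators of a finite set: local valuation-like behaviour of elements at a prime
propagates to finite sets. -/
theorem exists_common_denominator {A B : Type*} [CommRing A] [CommRing B] [Algebra A B]
    {P : Ideal A} [P.IsPrime]
    (h : ∀ b : B, ∃ m a : A, algebraMap A B a = m • b ∧ (m ∉ P ∨ a ∉ P)) (s : Finset B) :
    ∃ n : A, (∀ b ∈ s, ∃ a, algebraMap A B a = n • b) ∧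
      (n ∉ P ∨ ∃ b ∈ s, ∃ a ∉ P, algebraMap A B a = n • b) := by
  classical
  induction s using Finset.induction_on with
  | empty => exact ⟨1, by simp, Or.inl ((Ideal.ne_top_iff_one P).mp Ideal.IsPrime.ne_top')⟩
  | insert b s _ ih =>
    obtain ⟨n, hn, hP⟩ := ih
    -- Applied to nb rather than b: if m ∉ P, primality preserves the old witness; otherwise a = mnb
    -- is a new one.
    obtain ⟨m, a, ha, hma⟩ := h (n • b)
    refine ⟨m * n, ?_, ?_⟩
    · intro x hx
      obtain rfl | hx := Finset.mem_insert.mp hx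
      · exact ⟨a, by rw [ha, mul_smul]⟩
      · obtain ⟨c, hc⟩ := hn x hx
        exact ⟨m * c, by rw [map_mul, hc, mul_smul, Algebra.smul_def m]⟩
    · obtain hm | ha' := hma
      · obtain hn' | ⟨x, hx, c, hcP, hc⟩ := hP
        · exact Or.inl fun hmn => (Ideal.IsPrime.mem_or_mem ‹_› hmn).elim hm hn'
        · exact Or.inr ⟨x, Finset.mem_insert_of_mem hx, m * c,
            fun hmn => (Ideal.IsPrime.mem_or_mem ‹_› hmn).elim hm hcP,
            by rw [map_mul, hc, mul_smul, Algebra.smul_def m]⟩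
      · exact Or.inr ⟨b, Finset.mem_insert_self _ _, a, ha', by rw [ha, mul_smul]⟩

/-- Clear denominators with a common n: if n ∉ P, the coefficient 1 becomes n; otherwise some other
scaled coefficient stays outside P. -/
theorem exists_map_eq_C_mul {A B : Type*} [CommRing A] [CommRing B] [Algebra A B]
    (hinj : Function.Injective (algebraMap A B)) {P : Ideal A} [P.IsPrime]
    (h : ∀ b : B, ∃ m a : A, algebraMap A B a = m • b ∧ (m ∉ P ∨ a ∉ P))
    {f : B[X]} {j : ℕ} (hj : f.coeff j = 1) :
    ∃ (n : A) (g : A[X]), g.map (algebraMap A B) = C (algebraMap A B n) * f ∧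
      ∃ i, g.coeff i ∉ P := by
  classical
  obtain ⟨n, hn, hP⟩ := exists_common_denominator h (insert 0 (f.support.image f.coeff))
  have hmem : ∀ i, f.coeff i ∈ insert 0 (f.support.image f.coeff) := by
    intro i
    by_cases hi : f.coeff i = 0
    · simp [hi]
    · exact Finset.mem_insert_of_mem (Finset.mem_image_of_mem _ (mem_support_iff.mpr hi))
  have hl : C (algebraMap A B n) * f ∈ lifts (algebraMap A B) := by
    rw [lifts_iff_coeff_lifts]
    intro i
    obtain ⟨a, ha⟩ := hn _ (hmem i)
    exact ⟨a, by rw [ha, coeff_C_mul, Algebra.smul_def]⟩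
  obtain ⟨g, hg⟩ := (mem_lifts _).mp hl
  have hcoeff : ∀ i, algebraMap A B (g.coeff i) = n • f.coeff i := by
    intro i
    rw [← coeff_map, hg, coeff_C_mul, Algebra.smul_def]
  refine ⟨n, g, hg, ?_⟩
  obtain hnP | ⟨b, hb, a, haP, ha⟩ := hP
  · refine ⟨j, ?_⟩
    rwa [hinj ((hcoeff j).trans (by rw [hj, Algebra.smul_def, mul_one]) :
      algebraMap A B (g.coeff j) = algebraMap A B n)]
  · obtain rfl | hb := Finset.mem_insert.mp hb
    · exact absurd (hinj (by rw [ha, smul_zero, map_zero]) : a = 0)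
        fun h0 => haP (h0 ▸ P.zero_mem)
    · obtain ⟨i, -, rfl⟩ := Finset.mem_image.mp hb
      exact ⟨i, by rwa [hinj ((hcoeff i).trans ha.symm)]⟩

-- Primitivity in towers

attribute [local instance] Polynomial.algebra in
/-- Primitivity descends along integral extensions of the base. -/
theorem IsPrimitiveOver.of_isIntegral {R A S : Type*} [CommRing R] [CommRing A] [CommRing S]
    [Algebra R A] [Algebra A S] [Algebra R S] [IsScalarTower R A S] [Algebra.IsIntegral R A]
    {s : S} (hs : IsPrimitiveOver A s) : IsPrimitiveOver R s := by
  intro p hp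
  by_contra! hcon
  have halg : algebraMap R[X] A[X] = mapRingHom (algebraMap R A) := rfl
  -- If primitivity fails at p, the relations of s over `R` all lie in p[X]; going-up then yields a
  -- prime Q over p[X] containing the relations over `A`.
  obtain ⟨Q, hQJ, hQ, hQp⟩ := Ideal.exists_ideal_over_prime_of_isIntegral (S := A[X])
    (p.map (C : R →+* R[X])) (RingHom.ker (aeval s : A[X] →ₐ[A] S)) (by
      intro f hf
      rw [Ideal.mem_map_C_iff]
      refine hcon f ?_
      rw [Ideal.mem_comap, RingHom.mem_ker, halg, coe_mapRingHom] at hf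
      rwa [← aeval_map_algebraMap A])
  set P : Ideal A := Q.comap C with hP
  have hPp : P.IsPrime := Ideal.IsPrime.comap C
  have hle : P.map (C : A →+* A[X]) ≤ Q := Ideal.map_comap_le
  have hpP : p ≤ P.comap (algebraMap R A) := by
    intro x hx
    have : (C x : R[X]) ∈ Q.comap (algebraMap R[X] A[X]) := hQp ▸ Ideal.mem_map_of_mem C hx
    simpa [halg, hP] using this
  -- Incomparability: P[X] ⊆ Q both lie over p[X], so they coincide.
  have heq : Q ≤ P.map (C : A →+* A[X]) := by
    intro g hg
    by_contra hgP
    have hlt := Ideal.comap_lt_comap_of_integral_mem_sdiff (R := R[X]) hle ⟨hg, hgP⟩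
      (Algebra.IsIntegral.isIntegral g)
    rw [hQp] at hlt
    refine hlt.not_ge ?_
    rw [Ideal.map_le_iff_le_comap]
    intro x hx
    have hx' : algebraMap R A x ∈ P := hpP hx
    simpa [halg] using Ideal.mem_map_of_mem (C : A →+* A[X]) hx'
  obtain ⟨g, hg, i, hi⟩ := hs P hPp
  exact hi (Ideal.mem_map_C_iff.mp (heq (hQJ hg)) i)

/-- Primitivity ascends along extensions of the base. -/
theorem IsPrimitiveOver.tower_top {R A S : Type*} [CommRing R] [CommRing A] [CommRing S]
    [Algebra R A] [Algebra A S] [Algebra R S] [IsScalarTower R A S]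
    {s : S} (hs : IsPrimitiveOver R s) : IsPrimitiveOver A s := by
  intro P hP
  obtain ⟨f, hf, i, hi⟩ := hs (P.comap (algebraMap R A)) (Ideal.IsPrime.comap _)
  refine ⟨f.map (algebraMap R A), by rwa [aeval_map_algebraMap], i, ?_⟩
  rwa [coeff_map]

theorem mem_range_of_isIntegral_integralClosure {R B : Type*} [CommRing R] [CommRing B]
    [Algebra R B] (x : B) (hx : IsIntegral (integralClosure R B) x) :
    x ∈ (algebraMap (integralClosure R B) B).range :=
  ⟨⟨x, isIntegral_trans x hx⟩, rfl⟩

/-- If all elements of `B` are primitive over `R`, then so is any root of a polynomial over `B`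
with a coefficient equal to `1`. -/
theorem IsPrimitiveOver.trans {R B S : Type*} [CommRing R] [CommRing B] [CommRing S]
    [Algebra R B] [Algebra B S] [Algebra R S] [IsScalarTower R B S]
    (hB : ∀ b : B, IsPrimitiveOver R b) {s : S} {f : B[X]} (hf : aeval s f = 0) {j : ℕ}
    (hj : f.coeff j = 1) : IsPrimitiveOver R s := by
  refine IsPrimitiveOver.of_isIntegral (A := integralClosure R B) fun P hP => ?_
  obtain ⟨n, g, hg, hgP⟩ := exists_map_eq_C_mul (A := integralClosure R B) (B := B)
    Subtype.val_injective (P := P) (fun b => by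
      by_contra! hcon
      obtain ⟨q, hq, i, hi⟩ := (hB b).tower_top (A := integralClosure R B) P hP
      exact hi (coeff_mem_of_aeval_eq_zero mem_range_of_isIntegral_integralClosure hcon hq i)) hj
  refine ⟨g, ?_, hgP⟩
  rw [← aeval_map_algebraMap B, hg, map_mul, hf, mul_zero]

/-! ### Minimal extensions and finite chains -/

/-- Each element of a minimal extension `T` of `U` is a root of a polynomial over `U` with a
coefficient equal to `1`. -/
theorem exists_aeval_eq_zero_of_covBy {R S : Type*} [CommRing R] [CommRing S] [Algebra R S]
    {U T : Subalgebra R S} (h : U ⋖ T) {s : S} (hs : s ∈ T) :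
    ∃ f : U[X], aeval s f = 0 ∧ ∃ j, f.coeff j = 1 := by
  set V : Subalgebra R S := (Algebra.adjoin U {s ^ 2}).restrictScalars R with hV
  have hVT : ∀ x ∈ Algebra.adjoin U {s ^ 2}, x ∈ T := by
    intro x hx
    induction hx using Algebra.adjoin_induction with
    | mem x hx =>
      rw [Set.mem_singleton_iff.mp hx]
      exact T.pow_mem hs 2
    | algebraMap r => exact h.le r.2
    | add x y _ _ ihx ihy => exact T.add_mem ihx ihy
    | mul x y _ _ ihx ihy => exact T.mul_mem ihx ihy
  have hmem : ∀ x, x ∈ V ↔ x ∈ Algebra.adjoin U {s ^ 2} := fun x =>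
    Subalgebra.mem_restrictScalars R
  have hsV : s ^ 2 ∈ V := (hmem _).mpr (Algebra.subset_adjoin (Set.mem_singleton _))
  have hUV : U ≤ V := fun x hx =>
    (hmem x).mpr ((Algebra.adjoin U {s ^ 2}).algebraMap_mem ⟨x, hx⟩)
  obtain hEq | hEq := h.eq_or_eq hUV fun x hx => hVT x ((hmem x).mp hx)
  · rw [hEq] at hsV
    exact ⟨X ^ 2 - C ⟨s ^ 2, hsV⟩, by
      rw [map_sub, map_pow, aeval_X, aeval_C, sub_eq_zero]
      rfl, 2, by simp⟩
  · have hs' : s ∈ Algebra.adjoin U {s ^ 2} := (hmem s).mp (hEq ▸ hs)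
    rw [Algebra.adjoin_singleton_eq_range_aeval] at hs'
    obtain ⟨g, hg⟩ := hs'
    -- g(X²) has only even exponents, so the coefficient of X remains 1.
    refine ⟨X - expand U 2 g, ?_, 1, ?_⟩
    · rw [map_sub, aeval_X, expand_aeval]
      exact sub_eq_zero.mpr (Eq.symm hg)
    · simp [coeff_expand]

/-- In an FMC extension, every element is primitive over the base. -/
theorem IsFMCExtension.isPrimitiveOver {R S : Type*} [CommRing R] [CommRing S] [Algebra R S]
    [FaithfulSMul R S] (h : IsFMCExtension R S) (s : S) : IsPrimitiveOver R s := by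
  obtain ⟨K, hK, hfin⟩ := h
  have main : ∀ T ∈ K, ∀ t : T, IsPrimitiveOver R (t : S) := by
    intro T hT
    refine (hfin.wellFoundedOn (r := (· < ·))).induction hT (P := fun T => ∀ t : T,
      IsPrimitiveOver R (t : S)) fun T hT ih t => ?_
    obtain rfl | hbot := eq_or_ne T ⊥
    · obtain ⟨r, hr⟩ := Algebra.mem_bot.mp t.2
      exact fun p hp => ⟨X - C r, by simp [← hr], 1,
        by simpa using (Ideal.ne_top_iff_one p).mp hp.ne_top⟩
    obtain ⟨U, ⟨hUK, hUT⟩, hmax⟩ := (hfin.subset (Set.sep_subset K (· < T))).exists_maximal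
      ⟨⊥, hK.bot_mem, bot_lt_iff_ne_bot.mpr hbot⟩
    -- A ring strictly between U and T is comparable with the whole chain, so it belongs to it,
    -- against the choice of U.
    have hcov : U ⋖ T := by
      refine ⟨hUT, fun W hUW hWT => ?_⟩
      have hWK : W ∈ K := by
        have hchain : IsChain (· ≤ ·) (insert W K) := hK.1.insert fun Z hZ _ => by
          obtain hZT | hTZ := hK.1.total hZ hT
          · obtain rfl | hne := hZT.eq_or_lt
            · exact Or.inl hWT.le
            · obtain hZU | hUZ := hK.1.total hZ hUK
              · exact Or.inr (hZU.trans hUW.le)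
              · exact Or.inr ((hmax ⟨hZ, hne⟩ hUZ).trans hUW.le)
          · exact Or.inl (hWT.le.trans hTZ)
        exact hK.2 hchain (Set.subset_insert W K) ▸ Set.mem_insert W K
      exact (hmax ⟨hWK, hWT⟩ hUW.le).not_gt hUW
    obtain ⟨f, hf, j, hj⟩ := exists_aeval_eq_zero_of_covBy hcov t.2
    refine IsPrimitiveOver.trans (B := U) (fun b p hp => ?_) hf hj
    obtain ⟨g, hg, hgp⟩ := ih U hUK hUT b p hp
    exact ⟨g, Subtype.val_injective ((aeval_algebraMap_apply S b g).symm.trans hg), hgp⟩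
  exact main ⊤ hK.top_mem ⟨s, trivial⟩

/-! ### Flat epimorphisms from denominators -/

/-- If the denominators of every element of `T` generate the unit ideal of `T`, then so do the
common denominators of finitely many elements. -/
theorem span_common_denominators_eq_top {A T : Type*} [CommRing A] [CommRing T] [Algebra A T]
    (h : ∀ t : T, Ideal.span (algebraMap A T '' {m | m • t ∈ (algebraMap A T).range}) = ⊤)
    (s : Finset T) :
    Ideal.span (algebraMap A T '' {m | ∀ t ∈ s, m • t ∈ (algebraMap A T).range}) = ⊤ := by
  classical
  induction s using Finset.induction_on with
  | empty =>
    rw [Ideal.eq_top_iff_one]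
    exact Ideal.subset_span ⟨1, by simp, map_one _⟩
  | insert t s _ ih =>
    rw [eq_top_iff, ← Ideal.mul_top ⊤]
    nth_rw 1 [← h t]
    rw [← ih, Ideal.span_mul_span', Ideal.span_le]
    rintro _ ⟨_, ⟨m, hm, rfl⟩, _, ⟨n, hn, rfl⟩, rfl⟩
    refine Ideal.subset_span ⟨m * n, ?_, map_mul _ _ _⟩
    intro x hx
    obtain rfl | hx := Finset.mem_insert.mp hx
    · obtain ⟨a, ha⟩ := hm
      exact ⟨n * a, by rw [map_mul, ha, mul_comm m, mul_smul, Algebra.smul_def n]⟩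
    · obtain ⟨a, ha⟩ := hn x hx
      exact ⟨m * a, by rw [map_mul, ha, mul_smul, Algebra.smul_def m]⟩

/-- If the denominators of every element of `T` generate the unit ideal of `T`, then the injective
map `A → T` is a flat epimorphism. -/
theorem flat_and_isEpi_of_span_denominators {A T : Type*} [CommRing A] [CommRing T] [Algebra A T]
    (hinj : Function.Injective (algebraMap A T))
    (h : ∀ t : T, Ideal.span (algebraMap A T '' {m | m • t ∈ (algebraMap A T).range}) = ⊤) :
    Module.Flat A T ∧ Algebra.IsEpi A T := by
  classical
  have key : ∀ s : Finset T, ∃ (k : ℕ) (m : Fin k → A) (y : Fin k → T),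
      (∀ j, ∀ t ∈ s, m j • t ∈ (algebraMap A T).range) ∧ ∑ j, m j • y j = 1 := by
    intro s
    have h1 : (1 : T) ∈ Ideal.span (algebraMap A T ''
        {m | ∀ t ∈ s, m • t ∈ (algebraMap A T).range}) := by
      rw [span_common_denominators_eq_top h s]
      trivial
    obtain ⟨k, y, g, hsum⟩ := Submodule.mem_span_set'.mp h1
    choose m hm hmg using fun j => (g j).2
    refine ⟨k, m, y, hm, ?_⟩
    rw [← hsum]
    refine Finset.sum_congr rfl fun j _ => ?_
    rw [← hmg j, Algebra.smul_def, smul_eq_mul, mul_comm]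
  constructor
  · rw [Module.Flat.iff_forall_isTrivialRelation]
    intro l f x hfx
    obtain ⟨k, m, y, hm, hsum⟩ := key (Finset.univ.image x)
    choose a ha using fun i j => hm j (x i) (Finset.mem_image_of_mem _ (Finset.mem_univ i))
    refine ⟨k, a, y, fun i => ?_, fun j => hinj ?_⟩
    · calc x i = x i * ∑ j, m j • y j := by rw [hsum, mul_one]
        _ = ∑ j, a i j • y j := by
          rw [Finset.mul_sum]
          refine Finset.sum_congr rfl fun j _ => ?_
          rw [Algebra.smul_def (a i j), ha, smul_mul_assoc, mul_smul_comm]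
    · calc algebraMap A T (∑ i, f i * a i j) = ∑ i, m j • (f i • x i) := by
            rw [map_sum]
            refine Finset.sum_congr rfl fun i _ => ?_
            rw [map_mul, ha, Algebra.smul_def (f i), mul_smul_comm]
        _ = algebraMap A T 0 := by rw [← Finset.smul_sum, hfx, smul_zero, map_zero]
  · rw [Algebra.isEpi_iff_forall_one_tmul_eq]
    intro t
    obtain ⟨k, m, y, hm, hsum⟩ := key {t}
    choose a ha using fun j => hm j t (Finset.mem_singleton_self t)
    -- Slide m_j left to turn t into an element of `A`, then slide that back to the right.
    have hterm : ∀ j, t ⊗ₜ[A] (m j • y j) = (1 : T) ⊗ₜ[A] (t * (m j • y j)) := by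
      intro j
      rw [← TensorProduct.smul_tmul, ← ha, Algebra.algebraMap_eq_smul_one, TensorProduct.smul_tmul,
        mul_smul_comm, ← smul_mul_assoc, ← ha, ← Algebra.smul_def]
    calc (1 : T) ⊗ₜ[A] t = 1 ⊗ₜ[A] (t * ∑ j, m j • y j) := by rw [hsum, mul_one]
      _ = t ⊗ₜ[A] (∑ j, m j • y j) := by
        rw [Finset.mul_sum, TensorProduct.tmul_sum, TensorProduct.tmul_sum]
        exact Finset.sum_congr rfl fun j _ => (hterm j).symm
      _ = t ⊗ₜ[A] 1 := by rw [hsum]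

/-- If `A` is integrally closed in `T` and every element of `T` is primitive over `A`, then the
injective map `A → T` is a flat epimorphism. -/
theorem flat_and_isEpi_of_isPrimitiveOver {A T : Type*} [CommRing A] [CommRing T] [Algebra A T]
    (hinj : Function.Injective (algebraMap A T))
    (hAT : ∀ x : T, IsIntegral A x → x ∈ (algebraMap A T).range)
    (h : ∀ t : T, IsPrimitiveOver A t) : Module.Flat A T ∧ Algebra.IsEpi A T := by
  refine flat_and_isEpi_of_span_denominators hinj fun t => ?_
  by_contra htop
  obtain ⟨Q, hQ, hle⟩ := Ideal.exists_le_maximal _ htop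
  obtain ⟨f, hf, i, hi⟩ := h t (Q.comap (algebraMap A T)) (Ideal.IsPrime.comap _)
  refine hi (coeff_mem_of_aeval_eq_zero hAT (fun m a ha => ?_) hf i)
  have hm : algebraMap A T m ∈ Q := hle (Ideal.subset_span ⟨m, ⟨a, ha⟩, rfl⟩)
  refine ⟨hm, ?_⟩
  rw [Ideal.mem_comap, ha, Algebra.smul_def]
  exact Q.mul_mem_right _ hm

/-- Every FMC ring extension is quasi-Prüfer. -/
theorem corollary3p4 {R S : Type*} [CommRing R] [CommRing S] [Algebra R S] [FaithfulSMul R S]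
    (h : IsFMCExtension R S) : IsQuasiPruferExtension R S := by
  intro T
  have hinj : Function.Injective (algebraMap T S) := Subtype.val_injective
  refine flat_and_isEpi_of_isPrimitiveOver (fun x y hxy => ?_) (fun x hx => ?_) fun t => ?_
  · exact Subtype.ext (congrArg (algebraMap T S) hxy)
  · obtain ⟨a, ha⟩ := mem_range_of_isIntegral_integralClosure (x : S)
      (hx.map (IsScalarTower.toAlgHom (integralClosure R S) T S))
    exact ⟨a, Subtype.ext ha⟩
  · intro P hP
    obtain ⟨f, hf, hfP⟩ := (h.isPrimitiveOver (t : S)).tower_top (A := integralClosure R S) P hP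
    exact ⟨f, hinj (by rw [← aeval_algebraMap_apply, map_zero]; exact hf), hfP⟩
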